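/- Let $n\ge 2$ and let $f=(f_{ij})\in\mathcal S(E^1(n))=\mathcal S(S^2(\mathbb R^n))$, i.e. $f$ is a symmetric $2$-tensor field on $\mathbb R^n$ ($f_{ij}=f_{ji}$ for $1\le i,j\le n$) whose components are real-valued Schwartz functions. The elastic ray transform of $f$ is $$X^1f(x,\xi,\zeta)=\int_{\mathbb R}\sum_{i,j=1}^n f_{ij}(x+t\xi)\,\xi_i\zeta_j\,dt,\qquad x\in\mathbb R^n,\ \xi\in\mathbb S^{n-1},\ \zeta\in\mathbb R\xi\cup\xi^\perp .$$ Let $\mathrm d$ denote the symmetrized derivative, $(\mathrm d\phi)_i=\partial_{x_i}\phi$ for scalar fields and $(\mathrm du)_{ij}=\tfrac12(\partial_{x_j}u_i+\partial_{x_i}u_j)$ for $1$-tensor fields, and let $\mathcal R^1$ be the generalized Saint-Venant operator $$(\mathcal R^1f)_{ijk}=\frac{\partial f_{ij}}{\partial x_k}-\frac{\partial f_{ik}}{\partial x_j},\qquad 1\le i,j,k\le n .$$ Then the following conditions are equivalent: 1. $X^1f=0$ (for all $x$, $\xi$, $\zeta$ as above). 2. $f=\mathrm d^2\phi$ for some real-valued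 $\phi\in C^\infty(\mathbb R^n)$ such that $\phi(x)\to 0$ and $\partial_{x_i}\phi(x)\to0$ for every $i$ as $|x|\to\infty$. 3. $\mathcal R^1f=0$. -/

import Mathlib

open Filter Topology MeasureTheory
open scoped SchwartzMap ContDiff

noncomputable section

namespace ElasticRay

/-- `ℝⁿ` with its Euclidean norm. -/
abbrev Space (n : ℕ) : Type := EuclideanSpace ℝ (Fin n)

/-- The space `𝓢(E¹(n)) = 𝓢(S²(ℝⁿ))`: symmetric `2`-tensor fields on `ℝⁿ` whose components
are real Schwartz functions. -/
structure SchwartzTensor (n : ℕ) where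
  /-- The component `f_{ij}`. -/
  comp : Fin n → Fin n → 𝓢(Space n, ℝ)
  symm : ∀ i j, comp i j = comp j i

/-- The set of pairs `(ξ, ζ)`, where `ξ` is a unit vector and the polarization vector `ζ` lies in
`ℝ ξ ∪ ξ^⊥`. -/
def polarizations (n : ℕ) : Set (Space n × Space n) :=
  {p | ‖p.1‖ = 1 ∧ ((∃ c : ℝ, p.2 = c • p.1) ∨ inner ℝ p.1 p.2 = 0)}

/-- The elastic ray transform
`X¹ f (x, ξ, ζ) = ∫_ℝ ∑_{i,j} f_{ij}(x + t ξ) ξ_i ζ_j dt`. -/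
def elasticRayTransform {n : ℕ} (f : SchwartzTensor n) :
    Space n × polarizations n → ℝ :=
  fun p => ∫ t : ℝ, ∑ i, ∑ j,
    f.comp i j (p.1 + t • p.2.1.1) * p.2.1.1 i * p.2.1.2 j

/-- The partial derivative `∂u/∂x_i`. -/
def partialDeriv {n : ℕ} (i : Fin n) (u : Space n → ℝ) (x : Space n) : ℝ :=
  fderiv ℝ u x (EuclideanSpace.single i 1)

/-- The symmetrized derivative `d` on scalar fields: `(d φ)_i = ∂φ/∂x_i`. -/
def innerDiffScalar {n : ℕ} (φ : Space n → ℝ) : Fin n → Space n → ℝ :=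
  fun i x => partialDeriv i φ x

/-- The symmetrized derivative `d` on `1`-tensor fields:
`(d u)_{ij} = (∂u_i/∂x_j + ∂u_j/∂x_i) / 2`. -/
def innerDiffVector {n : ℕ} (u : Fin n → Space n → ℝ) : Fin n → Fin n → Space n → ℝ :=
  fun i j x => (partialDeriv j (u i) x + partialDeriv i (u j) x) / 2

/-- The generalized Saint-Venant operator
`(R¹ f)_{ijk} = ∂f_{ij}/∂x_k - ∂f_{ik}/∂x_j`. -/
def saintVenant {n : ℕ} (f : SchwartzTensor n) : Fin n → Fin n → Fin n → Space n → ℝ :=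
  fun i j k x => partialDeriv k (f.comp i j) x - partialDeriv j (f.comp i k) x

end ElasticRay

end

section Primitive

variable {E : Type*} [NormedAddCommGroup E] [NormedSpace ℝ E]

/-- A function whose derivative is a Schwartz `1`-form has limits along all rays, which are
approached at a uniform polynomial rate. -/
theorem exists_ray_limit_of_hasFDerivAt (A : 𝓢(E, E →L[ℝ] ℝ)) {v : E → ℝ}
    (hv : ∀ x, HasFDerivAt v (A x) x) {x : E} (hx : x ≠ 0) :
    ∃ m : ℝ, Tendsto (fun t : ℝ => v (t • x)) atTop (𝓝 m) ∧
      ∀ (k : ℕ) (C : ℝ), (∀ y, ‖y‖ ^ (k + 2) * ‖A y‖ ≤ C) → ‖x‖ ^ (k + 1) * |v x - m| ≤ C := by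
  have hxn : 0 < ‖x‖ := norm_pos_iff.2 hx
  have hderiv : ∀ t : ℝ, HasDerivAt (fun t : ℝ => v (t • x)) (A (t • x) x) t := fun t => by
    have h1 : HasDerivAt (fun t : ℝ => t • x) x t := by
      simpa using (hasDerivAt_id t).smul_const x
    exact (hv (t • x)).comp_hasDerivAt t h1
  have hbound : ∀ (k : ℕ) (C : ℝ), (∀ y, ‖y‖ ^ (k + 2) * ‖A y‖ ≤ C) →
      ∀ t ∈ Set.Ioi (1 : ℝ), ‖A (t • x) x‖ ≤ C / ‖x‖ ^ (k + 1) * t ^ (-2 : ℝ) := by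
    intro k C hC t ht
    have ht1 : (1 : ℝ) < t := ht
    have ht0 : 0 < t := by linarith
    have h1 := hC (t • x)
    rw [norm_smul, Real.norm_of_nonneg ht0.le, mul_pow] at h1
    have h2 : ‖A (t • x) x‖ ≤ ‖A (t • x)‖ * ‖x‖ := (A (t • x)).le_opNorm x
    have h3 : t ^ 2 ≤ t ^ (k + 2) := pow_le_pow_right₀ ht1.le (by omega)
    rw [Real.rpow_neg ht0.le, Real.rpow_two, ← div_eq_mul_inv, div_div,
      le_div_iff₀ (by positivity)]
    calc ‖A (t • x) x‖ * (‖x‖ ^ (k + 1) * t ^ 2)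
        ≤ ‖A (t • x)‖ * ‖x‖ * (‖x‖ ^ (k + 1) * t ^ (k + 2)) := by gcongr
      _ = t ^ (k + 2) * ‖x‖ ^ (k + 2) * ‖A (t • x)‖ := by ring
      _ ≤ C := h1
  have hint2 : IntegrableOn (fun t : ℝ => t ^ (-2 : ℝ)) (Set.Ioi 1) :=
    integrableOn_Ioi_rpow_of_lt (by norm_num) one_pos
  have hcont : Continuous fun t : ℝ => A (t • x) x := by
    have := A.continuous
    fun_prop
  have hint : IntegrableOn (fun t : ℝ => A (t • x) x) (Set.Ioi 1) := by
    refine Integrable.mono' (hint2.const_mul (SchwartzMap.seminorm ℝ 2 0 A / ‖x‖ ^ (0 + 1)))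
      hcont.aestronglyMeasurable ?_
    exact (ae_restrict_iff' measurableSet_Ioi).2 (Eventually.of_forall
      (hbound 0 _ (fun y => A.norm_pow_mul_le_seminorm ℝ (0 + 2) y)))
  have hlim := tendsto_limUnder_of_hasDerivAt_of_integrableOn_Ioi (fun t _ => hderiv t) hint
  refine ⟨_, hlim, fun k C hC => ?_⟩
  have hI := integral_Ioi_of_hasDerivAt_of_tendsto' (fun t _ => hderiv t) hint hlim
  have hle : ‖∫ t in Set.Ioi (1 : ℝ), A (t • x) x‖
      ≤ ∫ t in Set.Ioi (1 : ℝ), C / ‖x‖ ^ (k + 1) * t ^ (-2 : ℝ) :=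
    norm_integral_le_of_norm_le (hint2.const_mul _)
      ((ae_restrict_iff' measurableSet_Ioi).2 (Eventually.of_forall (hbound k C hC)))
  rw [hI, integral_const_mul, integral_Ioi_rpow_of_lt (by norm_num) one_pos, one_smul,
    Real.norm_eq_abs, abs_sub_comm] at hle
  norm_num at hle
  rwa [le_div_iff₀ (by positivity), mul_comm] at hle

/-- In dimension at least two, a primitive of a Schwartz `1`-form has the same limit along
all rays. -/
theorem exists_uniform_ray_limit_of_hasFDerivAt (hE : 1 < Module.rank ℝ E)
    (A : 𝓢(E, E →L[ℝ] ℝ)) {v : E → ℝ} (hv : ∀ x, HasFDerivAt v (A x) x) :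
    ∃ m : ℝ, ∀ x ≠ 0, Tendsto (fun t : ℝ => v (t • x)) atTop (𝓝 m) := by
  choose! L hL _ using fun (x : E) (hx : x ≠ 0) => exists_ray_limit_of_hasFDerivAt A hv hx
  have hC := fun y => A.norm_pow_mul_le_seminorm ℝ 2 y
  set C := SchwartzMap.seminorm ℝ 2 0 A
  have hloc : ∀ x : E, x ≠ 0 → ∀ y ∈ Metric.ball x (‖x‖ / 2), L y = L x := by
    intro x hx y hy
    have hr : 0 < ‖x‖ / 2 := by positivity
    have hball : ∀ z ∈ Metric.ball x (‖x‖ / 2), ‖x‖ / 2 ≤ ‖z‖ := by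
      intro z hz
      rw [mem_ball_iff_norm'] at hz
      have := norm_sub_norm_le x z
      linarith
    have hy0 : y ≠ 0 := norm_pos_iff.1 (hr.trans_le (hball y hy))
    have hest : ∀ᶠ t : ℝ in atTop,
        ‖v (t • y) - v (t • x)‖ ≤ C / (‖x‖ / 2) ^ 2 * ‖y - x‖ * t⁻¹ := by
      filter_upwards [eventually_gt_atTop 0] with t ht
      have hd : ∀ z ∈ Metric.ball x (‖x‖ / 2), HasFDerivWithinAt (fun z => v (t • z))
          (t • A (t • z)) (Metric.ball x (‖x‖ / 2)) z := by
        intro z _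
        have h1 : HasFDerivAt (fun z : E => t • z) (t • ContinuousLinearMap.id ℝ E) z :=
          (hasFDerivAt_id z).const_smul t
        have h2 := (hv (t • z)).comp z h1
        refine (h2.congr_fderiv ?_).hasFDerivWithinAt
        ext w
        simp
      have hb : ∀ z ∈ Metric.ball x (‖x‖ / 2),
          ‖t • A (t • z)‖ ≤ C / (‖x‖ / 2) ^ 2 * t⁻¹ := by
        intro z hz
        have h1 := hC (t • z)
        rw [norm_smul, Real.norm_of_nonneg ht.le, mul_pow] at h1
        rw [norm_smul, Real.norm_of_nonneg ht.le, ← div_eq_mul_inv, div_div,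
          le_div_iff₀ (by positivity)]
        calc t * ‖A (t • z)‖ * ((‖x‖ / 2) ^ 2 * t)
            ≤ t * ‖A (t • z)‖ * (‖z‖ ^ 2 * t) := by gcongr; exact hball z hz
          _ = t ^ 2 * ‖z‖ ^ 2 * ‖A (t • z)‖ := by ring
          _ ≤ C := h1
      refine ((convex_ball x _).norm_image_sub_le_of_norm_hasFDerivWithin_le hd hb
        (Metric.mem_ball_self hr) hy).trans_eq ?_
      ring
    have hz : Tendsto (fun t : ℝ => v (t • y) - v (t • x)) atTop (𝓝 0) := by
      refine squeeze_zero_norm' hest ?_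
      have h0 : Tendsto (fun t : ℝ => t⁻¹) atTop (𝓝 0) := tendsto_inv_atTop_zero
      simpa only [mul_zero] using h0.const_mul (C / (‖x‖ / 2) ^ 2 * ‖y - x‖)
    exact sub_eq_zero.1 (tendsto_nhds_unique ((hL y hy0).sub (hL x hx)) hz)
  have hconn : IsPreconnected ({0}ᶜ : Set E) :=
    (isConnected_compl_singleton_of_one_lt_rank hE 0).isPreconnected
  have : PreconnectedSpace ({0}ᶜ : Set E) := isPreconnected_iff_preconnectedSpace.1 hconn
  have hlc : IsLocallyConstant fun x : ({0}ᶜ : Set E) => L x := by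
    refine (IsLocallyConstant.iff_eventually_eq _).2 fun x => ?_
    have hx : (x : E) ≠ 0 := x.2
    exact continuous_subtype_val.continuousAt.eventually
      (Filter.mem_of_superset (Metric.ball_mem_nhds (x : E) (half_pos (norm_pos_iff.2 hx)))
        (hloc x hx))
  obtain ⟨m, hm⟩ := hlc.exists_eq_const
  refine ⟨m, fun x hx => ?_⟩
  have h := congrFun hm ⟨x, hx⟩
  simp only [Function.const_apply] at h
  exact h ▸ hL x hx

/-- In dimension at least two, a closed Schwartz `1`-form has a Schwartz primitive. -/
theorem SchwartzMap.exists_primitive_of_closed (hE : 1 < Module.rank ℝ E)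
    (A : 𝓢(E, E →L[ℝ] ℝ)) (hA : ∀ x y z, fderiv ℝ A x y z = fderiv ℝ A x z y) :
    ∃ u : 𝓢(E, ℝ), ∀ x, HasFDerivAt u (A x) x := by
  obtain ⟨w, hw⟩ := convex_univ.exists_forall_hasFDerivAt_of_fderiv_symmetric isOpen_univ
    A.differentiable.differentiableOn (fun a _ x y => hA a x y)
  replace hw : ∀ x, HasFDerivAt w (A x) x := fun x => hw x trivial
  obtain ⟨m, hm⟩ := exists_uniform_ray_limit_of_hasFDerivAt hE A hw
  have hderiv : ∀ x, HasFDerivAt (fun x => w x - m) (A x) x := fun x => (hw x).sub_const m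
  have hfd : fderiv ℝ (fun x => w x - m) = A := funext fun x => (hderiv x).fderiv
  have hdecay : ∀ k : ℕ, ∃ C, ∀ x, ‖x‖ ^ (k + 1) * |w x - m| ≤ C := by
    intro k
    have hC := fun y => A.norm_pow_mul_le_seminorm ℝ (k + 2) y
    refine ⟨SchwartzMap.seminorm ℝ (k + 2) 0 A, fun x => ?_⟩
    by_cases hx : x = 0
    · simp [hx]
    · obtain ⟨m', hm', hb⟩ := exists_ray_limit_of_hasFDerivAt A hw hx
      rw [tendsto_nhds_unique (hm x hx) hm']
      exact hb k _ hC
  refine ⟨⟨fun x => w x - m, ?_, ?_⟩, hderiv⟩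
  · rw [contDiff_infty_iff_fderiv, hfd]
    exact ⟨fun x => (hderiv x).differentiableAt, A.smooth ⊤⟩
  · rintro k (_ | n)
    · simp only [norm_iteratedFDeriv_zero, Real.norm_eq_abs]
      rcases k with _ | k
      · obtain ⟨C, hC⟩ := hdecay 0
        set D := SchwartzMap.seminorm ℝ 0 0 A
        have hD : 0 ≤ D := apply_nonneg _ A
        refine ⟨max C (|w 0 - m| + D), fun x => ?_⟩
        rw [pow_zero, one_mul]
        rcases le_total 1 ‖x‖ with hx | hx
        · refine le_max_of_le_left (le_trans ?_ (hC x))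
          simpa using le_mul_of_one_le_left (abs_nonneg (w x - m)) hx
        · refine le_max_of_le_right ?_
          have h1 := convex_univ.norm_image_sub_le_of_norm_hasFDerivWithin_le
            (fun z _ => (hderiv z).hasFDerivWithinAt)
            (fun z _ => A.norm_le_seminorm ℝ z) (Set.mem_univ 0) (Set.mem_univ x)
          have h2 : |w x - m| - |w 0 - m| ≤ ‖w x - m - (w 0 - m)‖ := abs_sub_abs_le_abs_sub _ _
          have h3 : D * ‖x - 0‖ ≤ D * 1 := by gcongr; simpa using hx
          linarith
      · exact hdecay k
    · obtain ⟨C, hC⟩ := A.decay' k n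
      refine ⟨C, fun x => ?_⟩
      rw [← norm_iteratedFDeriv_fderiv, hfd]
      exact hC x

end Primitive

section Slice

open scoped FourierTransform

variable {E : Type*} [NormedAddCommGroup E] [InnerProductSpace ℝ E] [FiniteDimensional ℝ E]
  [MeasurableSpace E] [BorelSpace E]

theorem measurePreserving_prod_sub_inner (ξ : E) :
    MeasurePreserving (fun p : E × ℝ => (p.1, p.2 - inner ℝ p.1 ξ))
      (volume.prod volume) (volume.prod volume) := by
  refine (MeasurePreserving.id volume).skew_product
    (g := fun (x : E) (t : ℝ) => t - inner ℝ x ξ) ?_ ?_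
  · exact (by fun_prop : Continuous fun p : E × ℝ => p.2 - inner ℝ p.1 ξ).measurable
  · exact Eventually.of_forall fun x => (measurePreserving_sub_right volume _).map_eq

theorem measurePreserving_prod_add_smul (ξ : E) :
    MeasurePreserving (fun p : ℝ × E => (p.1, p.2 + p.1 • ξ))
      (volume.prod volume) (volume.prod volume) := by
  refine (MeasurePreserving.id volume).skew_product
    (g := fun (t : ℝ) (x : E) => x + t • ξ) ?_ ?_
  · exact (by fun_prop : Continuous fun p : ℝ × E => p.2 + p.1 • ξ).measurable
  · exact Eventually.of_forall fun x => (measurePreserving_add_right volume _).map_eq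

/-- Fourier slice theorem, vanishing case: if all integrals of `h` over lines of direction `ξ`
vanish, then so does the Fourier transform of `h` on the hyperplane `ξ^⊥`. -/
theorem fourier_eq_zero_of_integral_line_eq_zero {h : E → ℂ} (hh : Integrable h) {ξ η : E}
    (hξ : ‖ξ‖ = 1) (hξη : inner ℝ ξ η = 0) (hX : ∀ x, ∫ t : ℝ, h (x + t • ξ) = 0) :
    𝓕 h η = 0 := by
  set c : E → ℂ := fun x => Complex.exp (↑(-2 * Real.pi * inner ℝ x η) * Complex.I) with hc
  set G : ℝ → ℂ := fun t => ((Real.exp (-Real.pi * t ^ 2) : ℝ) : ℂ) with hG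
  have hGint : Integrable G := (integrable_exp_neg_mul_sq Real.pi_pos).ofReal
  have hG1 : ∫ t, G t = 1 := by
    rw [hG, integral_complex_ofReal, integral_gaussian, div_self Real.pi_ne_zero]
    simp
  have hcc : Continuous c := by fun_prop
  have hcint : Integrable fun x => c x * h x := by
    refine hh.bdd_mul (c := 1) hcc.aestronglyMeasurable (Eventually.of_forall fun x => ?_)
    rw [hc, Complex.norm_exp_ofReal_mul_I]
  have hF : Integrable (fun p : E × ℝ => c p.1 * h p.1 * G (p.2 - inner ℝ p.1 ξ))
      (volume.prod volume) :=
    (measurePreserving_prod_sub_inner ξ).integrable_comp_of_integrable (hcint.mul_prod hGint)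
  have hF' : Integrable (fun p : ℝ × E => c (p.2 + p.1 • ξ) * h (p.2 + p.1 • ξ) *
      G (p.1 - inner ℝ (p.2 + p.1 • ξ) ξ)) (volume.prod volume) :=
    (measurePreserving_prod_add_smul ξ).integrable_comp_of_integrable hF.swap
  calc 𝓕 h η = ∫ x, c x * h x := by rw [Real.fourier_eq']; rfl
    _ = ∫ x, ∫ t, c x * h x * G (t - inner ℝ x ξ) := by
      refine integral_congr_ae (Eventually.of_forall fun x => ?_)
      simp only
      rw [integral_const_mul, integral_sub_right_eq_self G, hG1, mul_one]
    _ = ∫ t, ∫ x, c x * h x * G (t - inner ℝ x ξ) := integral_integral_swap hF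
    _ = ∫ t : ℝ, ∫ x, c (x + t • ξ) * h (x + t • ξ) * G (t - inner ℝ (x + t • ξ) ξ) := by
      refine integral_congr_ae (Eventually.of_forall fun t => ?_)
      exact (integral_add_right_eq_self (fun x => c x * h x * G (t - inner ℝ x ξ)) (t • ξ)).symm
    _ = ∫ x, ∫ t : ℝ, c (x + t • ξ) * h (x + t • ξ) * G (t - inner ℝ (x + t • ξ) ξ) :=
      integral_integral_swap hF'
    _ = ∫ x, ∫ t : ℝ, c x * G (- inner ℝ x ξ) * h (x + t • ξ) := by
      refine integral_congr_ae (Eventually.of_forall fun x => ?_)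
      refine integral_congr_ae (Eventually.of_forall fun t => ?_)
      have h1 : inner ℝ (x + t • ξ) η = inner ℝ x η := by
        rw [inner_add_left, inner_smul_left, hξη]; simp
      have h2 : t - inner ℝ (x + t • ξ) ξ = - inner ℝ x ξ := by
        rw [inner_add_left, inner_smul_left, real_inner_self_eq_norm_sq, hξ]; simp
      simp only [h2, hc, h1]
      ring
    _ = 0 := by simp [integral_const_mul, hX]

end Slice

namespace ElasticRay

open scoped FourierTransform LineDeriv

variable {n : ℕ}

theorem contDiff_partialDeriv {ψ : Space n → ℝ} (hψ : ContDiff ℝ ∞ ψ) (i : Fin n) :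
    ContDiff ℝ ∞ (partialDeriv i ψ) :=
  (contDiff_infty_iff_fderiv.1 hψ).2.clm_apply contDiff_const

theorem fderiv_partialDeriv_apply {ψ : Space n → ℝ} (hψ : ContDiff ℝ ∞ ψ) (i : Fin n)
    (x v : Space n) :
    fderiv ℝ (partialDeriv i ψ) x v = fderiv ℝ (fderiv ℝ ψ) x v (EuclideanSpace.single i 1) := by
  have h : DifferentiableAt ℝ (fderiv ℝ ψ) x :=
    (contDiff_infty_iff_fderiv.1 hψ).2.differentiable (by simp) x
  change fderiv ℝ (fun y => fderiv ℝ ψ y (EuclideanSpace.single i 1)) x v = _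
  rw [fderiv_clm_apply h (differentiableAt_const _)]
  simp

theorem partialDeriv_comm {ψ : Space n → ℝ} (hψ : ContDiff ℝ ∞ ψ) (i j : Fin n) (x : Space n) :
    partialDeriv i (partialDeriv j ψ) x = partialDeriv j (partialDeriv i ψ) x := by
  have h : IsSymmSndFDerivAt ℝ ψ x := hψ.contDiffAt.isSymmSndFDerivAt (by
    rw [minSmoothness_of_isRCLikeNormedField]; exact WithTop.coe_le_coe.2 le_top)
  rw [partialDeriv, partialDeriv, fderiv_partialDeriv_apply hψ, fderiv_partialDeriv_apply hψ]
  exact h _ _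

/-- The second symmetrized derivative of a smooth function is its Hessian. -/
theorem innerDiffVector_innerDiffScalar {φ : Space n → ℝ} (hφ : ContDiff ℝ ∞ φ) (i j : Fin n)
    (x : Space n) :
    innerDiffVector (innerDiffScalar φ) i j x = partialDeriv j (partialDeriv i φ) x := by
  change (partialDeriv j (partialDeriv i φ) x + partialDeriv i (partialDeriv j φ) x) / 2 = _
  rw [partialDeriv_comm hφ i j]
  ring

theorem saintVenant_eq_zero_of_potential (f : SchwartzTensor n) {φ : Space n → ℝ}
    (hφ : ContDiff ℝ ∞ φ)
    (hf : ∀ i j x, f.comp i j x = innerDiffVector (innerDiffScalar φ) i j x) :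
    saintVenant f = 0 := by
  have hf' : ∀ i j, ⇑(f.comp i j) = partialDeriv j (partialDeriv i φ) := fun i j =>
    funext fun x => (hf i j x).trans (innerDiffVector_innerDiffScalar hφ i j x)
  funext i j k x
  simp only [saintVenant, hf', partialDeriv_comm (contDiff_partialDeriv hφ i) k j, sub_self,
    Pi.zero_apply]

/-- The `1`-form with components `α`. -/
noncomputable def formOfComponents (α : Fin n → 𝓢(Space n, ℝ)) :
    𝓢(Space n, Space n →L[ℝ] ℝ) :=
  ∑ j, (α j).postcompCLM (ContinuousLinearMap.toSpanSingleton ℝ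
    (EuclideanSpace.proj j : Space n →L[ℝ] ℝ))

theorem formOfComponents_apply (α : Fin n → 𝓢(Space n, ℝ)) (x : Space n) :
    formOfComponents α x = ∑ j, α j x • (EuclideanSpace.proj j : Space n →L[ℝ] ℝ) := by
  simp [formOfComponents]

theorem fderiv_formOfComponents_apply (α : Fin n → 𝓢(Space n, ℝ)) (x v w : Space n) :
    fderiv ℝ (formOfComponents α) x v w = ∑ j, fderiv ℝ (α j) x v * w j := by
  have h : HasFDerivAt (formOfComponents α) (∑ j, (fderiv ℝ (α j) x).smulRight
      (EuclideanSpace.proj j : Space n →L[ℝ] ℝ)) x := by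
    rw [show ⇑(formOfComponents α) =
      fun x => ∑ j, α j x • (EuclideanSpace.proj j : Space n →L[ℝ] ℝ) from
      funext (formOfComponents_apply α)]
    exact HasFDerivAt.fun_sum fun j _ =>
      ((α j).differentiableAt (x := x)).hasFDerivAt.smul_const
        (EuclideanSpace.proj j : Space n →L[ℝ] ℝ)
  rw [h.fderiv]
  simp

theorem fderiv_eq_sum_partialDeriv (u : Space n → ℝ) (x v : Space n) :
    fderiv ℝ u x v = ∑ k, v k * partialDeriv k u x := by
  conv_lhs => rw [← (EuclideanSpace.basisFun (Fin n) ℝ).sum_repr v]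
  simp [partialDeriv]

/-- Components satisfying the closedness relations are the partial derivatives of a Schwartz
function. -/
theorem exists_schwartz_partialDeriv_eq (hn : 2 ≤ n) (α : Fin n → 𝓢(Space n, ℝ))
    (hα : ∀ j k x, partialDeriv k (α j) x = partialDeriv j (α k) x) :
    ∃ u : 𝓢(Space n, ℝ), ∀ j x, partialDeriv j u x = α j x := by
  have hrank : 1 < Module.rank ℝ (Space n) := by
    rw [← Module.finrank_eq_rank, finrank_euclideanSpace_fin]
    exact_mod_cast hn
  obtain ⟨u, hu⟩ := SchwartzMap.exists_primitive_of_closed hrank (formOfComponents α) (by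
    intro x y z
    simp only [fderiv_formOfComponents_apply, fderiv_eq_sum_partialDeriv, Finset.sum_mul]
    rw [Finset.sum_comm]
    refine Finset.sum_congr rfl fun j _ => Finset.sum_congr rfl fun k _ => ?_
    rw [hα k j]
    ring)
  refine ⟨u, fun j x => ?_⟩
  rw [partialDeriv, (hu x).fderiv, formOfComponents_apply]
  simp

theorem partialDeriv_comp_eq_of_saintVenant {f : SchwartzTensor n} (hf : saintVenant f = 0)
    (i j k : Fin n) (x : Space n) :
    partialDeriv k (f.comp i j) x = partialDeriv j (f.comp i k) x :=
  sub_eq_zero.1 (congrFun (congrFun (congrFun (congrFun hf i) j) k) x)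

theorem exists_schwartz_vector_of_saintVenant (hn : 2 ≤ n) {f : SchwartzTensor n}
    (hf : saintVenant f = 0) :
    ∃ u : Fin n → 𝓢(Space n, ℝ), ∀ i j x, partialDeriv j (u i) x = f.comp i j x := by
  choose u hu using fun i => exists_schwartz_partialDeriv_eq hn (f.comp i)
    (partialDeriv_comp_eq_of_saintVenant hf i)
  exact ⟨u, hu⟩

theorem exists_schwartz_potential_of_saintVenant (hn : 2 ≤ n) {f : SchwartzTensor n}
    (hf : saintVenant f = 0) :
    ∃ (φ : 𝓢(Space n, ℝ)) (u : Fin n → 𝓢(Space n, ℝ)), (∀ i, partialDeriv i φ = u i) ∧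
      ∀ i j x, f.comp i j x = innerDiffVector (innerDiffScalar φ) i j x := by
  obtain ⟨u, hu⟩ := exists_schwartz_vector_of_saintVenant hn hf
  obtain ⟨φ, hφ⟩ := exists_schwartz_partialDeriv_eq hn u fun j k x => by
    rw [hu, hu, f.symm]
  have hφ' : ∀ i, partialDeriv i φ = u i := fun i => funext (hφ i)
  refine ⟨φ, u, hφ', fun i j x => ?_⟩
  rw [innerDiffVector_innerDiffScalar (φ.smooth ⊤), hφ', hu]

/-- The restriction of a Schwartz function to a line. -/
theorem exists_schwartz_line (u : 𝓢(Space n, ℝ)) (x : Space n) {ξ : Space n} (hξ : ‖ξ‖ = 1) :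
    ∃ w : 𝓢(ℝ, ℝ), ∀ t, w t = u (x + t • ξ) := by
  have hg : (fun t : ℝ => x + t • ξ).HasTemperateGrowth := by fun_prop
  have hanti : AntilipschitzWith 1 fun t : ℝ => x + t • ξ :=
    AntilipschitzWith.of_le_mul_dist fun s t => by
      simp [dist_eq_norm, ← sub_smul, norm_smul, hξ]
  exact ⟨SchwartzMap.compCLMOfAntilipschitz ℝ hg hanti u, fun t => rfl⟩

theorem integrable_line (u : 𝓢(Space n, ℝ)) (x : Space n) {ξ : Space n} (hξ : ‖ξ‖ = 1) :
    Integrable fun t : ℝ => u (x + t • ξ) := by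
  obtain ⟨w, hw⟩ := exists_schwartz_line u x hξ
  exact w.integrable.congr (Eventually.of_forall hw)

theorem integral_fderiv_line (u : 𝓢(Space n, ℝ)) (x : Space n) {ξ : Space n} (hξ : ‖ξ‖ = 1) :
    Integrable (fun t : ℝ => fderiv ℝ u (x + t • ξ) ξ) ∧
      ∫ t : ℝ, fderiv ℝ u (x + t • ξ) ξ = 0 := by
  obtain ⟨w, hw⟩ := exists_schwartz_line u x hξ
  have hint : Integrable fun t : ℝ => fderiv ℝ u (x + t • ξ) ξ := by
    exact integrable_line (∂_{ξ} u) x hξ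
  have hd : ∀ t, HasDerivAt w (fderiv ℝ u (x + t • ξ) ξ) t := fun t => by
    have h1 : HasDerivAt (fun t : ℝ => x + t • ξ) ξ t := by
      simpa using ((hasDerivAt_id t).smul_const ξ).const_add x
    rw [show ⇑w = u ∘ fun t : ℝ => x + t • ξ from funext hw]
    exact (u.differentiableAt.hasFDerivAt).comp_hasDerivAt t h1
  have hlim : Tendsto w (cocompact ℝ) (𝓝 0) := zero_at_infty w
  refine ⟨hint, ?_⟩
  simpa using integral_of_hasDerivAt_of_tendsto hd hint (hlim.mono_left atBot_le_cocompact)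
    (hlim.mono_left atTop_le_cocompact)

theorem elasticRayTransform_eq_zero_of_saintVenant (hn : 2 ≤ n) {f : SchwartzTensor n}
    (hf : saintVenant f = 0) : elasticRayTransform f = 0 := by
  obtain ⟨u, hu⟩ := exists_schwartz_vector_of_saintVenant hn hf
  funext ⟨x, ⟨ξ, ζ⟩, hξ, _⟩
  simp only at hξ
  have h : ∀ t : ℝ, ∑ i, ∑ j, f.comp i j (x + t • ξ) * ξ i * ζ j =
      ∑ j, fderiv ℝ (u j) (x + t • ξ) ξ * ζ j := fun t => by
    rw [Finset.sum_comm]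
    refine Finset.sum_congr rfl fun j _ => ?_
    rw [fderiv_eq_sum_partialDeriv, Finset.sum_mul]
    refine Finset.sum_congr rfl fun i _ => ?_
    rw [hu, f.symm]
    ring
  simp only [elasticRayTransform, h, Pi.zero_apply]
  rw [integral_finsetSum _ fun j _ => (integral_fderiv_line (u j) x hξ).1.mul_const _]
  simp [integral_mul_const, (integral_fderiv_line _ x hξ).2]

/-- If the elastic ray transform vanishes, then so does the longitudinal ray transform of each row
of the tensor field. -/
theorem integral_row_eq_zero {f : SchwartzTensor n} (hf : elasticRayTransform f = 0)
    (x : Space n) {ξ : Space n} (hξ : ‖ξ‖ = 1) (i : Fin n) :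
    ∫ t : ℝ, ∑ j, ξ j * f.comp i j (x + t • ξ) = 0 := by
  set I : Fin n → ℝ := fun b => ∫ t : ℝ, ∑ j, ξ j * f.comp b j (x + t • ξ) with hI
  have hint : ∀ b, Integrable fun t : ℝ => ∑ j, ξ j * f.comp b j (x + t • ξ) := fun b =>
    integrable_finsetSum _ fun j _ => (integrable_line (f.comp b j) x hξ).const_mul _
  have key : ∀ ζ : Space n, ((∃ c : ℝ, ζ = c • ξ) ∨ inner ℝ ξ ζ = 0) →
      ∑ b, I b * ζ b = 0 := by
    intro ζ hζ
    have h := congrFun hf (x, ⟨(ξ, ζ), hξ, hζ⟩)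
    simp only [elasticRayTransform, Pi.zero_apply] at h
    simp only [hI, ← integral_mul_const]
    rw [← integral_finsetSum _ fun b _ => (hint b).mul_const _, ← h]
    refine integral_congr_ae (Eventually.of_forall fun t => ?_)
    simp only [Finset.sum_mul]
    rw [Finset.sum_comm]
    refine Finset.sum_congr rfl fun a _ => Finset.sum_congr rfl fun b _ => ?_
    rw [f.symm b a]
    ring
  set e : Space n := EuclideanSpace.single i 1 with he
  have h1 := key (inner ℝ ξ e • ξ) (Or.inl ⟨_, rfl⟩)
  have h2 := key (e - inner ℝ ξ e • ξ) (Or.inr (by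
    rw [inner_sub_right, inner_smul_right, real_inner_self_eq_norm_sq, hξ]; ring))
  have h3 : ∑ b, I b * e b = 0 := by
    simp only [PiLp.sub_apply, mul_sub, Finset.sum_sub_distrib, h1, sub_zero] at h2
    exact h2
  simpa [he, Pi.single_apply] using h3

/-- The complexification of a real Schwartz function. -/
noncomputable def complexify (u : 𝓢(Space n, ℝ)) : 𝓢(Space n, ℂ) :=
  u.postcompCLM Complex.ofRealCLM

theorem complexify_apply (u : 𝓢(Space n, ℝ)) (x : Space n) : complexify u x = (u x : ℂ) := rfl

/-- If the elastic ray transform vanishes, then the Fourier transform of each row of the tensor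
field at `η` is parallel to `η`. -/
theorem sum_fourier_row_eq_zero {f : SchwartzTensor n} (hf : elasticRayTransform f = 0)
    (i : Fin n) {ξ η : Space n} (hξη : inner ℝ ξ η = 0) :
    ∑ j, (ξ j : ℂ) * 𝓕 (complexify (f.comp i j)) η = 0 := by
  rcases eq_or_ne ξ 0 with rfl | hξ0
  · simp
  set θ : Space n := ‖ξ‖⁻¹ • ξ with hθ
  have hθ1 : ‖θ‖ = 1 := norm_smul_inv_norm hξ0
  set H : 𝓢(Space n, ℂ) := ∑ j, (θ j : ℂ) • complexify (f.comp i j) with hH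
  have hHx : ∀ x, H x = ((∑ j, θ j * f.comp i j x : ℝ) : ℂ) := fun x => by
    simp [hH, complexify_apply]
  have hzero : 𝓕 (H : Space n → ℂ) η = 0 := by
    refine fourier_eq_zero_of_integral_line_eq_zero H.integrable hθ1 ?_ fun x => ?_
    · rw [hθ, inner_smul_left, hξη, mul_zero]
    · simp only [hHx]
      rw [integral_complex_ofReal, integral_row_eq_zero hf x hθ1 i, Complex.ofReal_zero]
  rw [← SchwartzMap.fourier_coe] at hzero
  have hsum : 𝓕 H η = ∑ j, (θ j : ℂ) * 𝓕 (complexify (f.comp i j)) η := by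
    rw [← SchwartzMap.fourierTransformCLM_apply ℂ, hH, map_sum, sum_apply]
    simp [SchwartzMap.fourierTransformCLM_apply]
  have hξθ : ∀ j, (ξ j : ℂ) = (‖ξ‖ : ℂ) * (θ j : ℂ) := fun j => by
    rw [← Complex.ofReal_mul, hθ, PiLp.smul_apply, smul_eq_mul,
      mul_inv_cancel_left₀ (norm_ne_zero_iff.2 hξ0)]
  simp only [hξθ, mul_assoc]
  rw [← Finset.mul_sum, ← hsum, hzero, mul_zero]

theorem lineDerivOp_complexify_apply (u : 𝓢(Space n, ℝ)) (k : Fin n) (x : Space n) :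
    (∂_{(EuclideanSpace.single k 1 : Space n)} (complexify u)) x = (partialDeriv k u x : ℂ) := by
  rw [SchwartzMap.lineDerivOp_apply_eq_fderiv]
  have h : HasFDerivAt (complexify u) (Complex.ofRealCLM.comp (fderiv ℝ u x)) x :=
    Complex.ofRealCLM.hasFDerivAt.comp x u.differentiableAt.hasFDerivAt
  rw [h.fderiv]
  rfl

theorem fourier_lineDerivOp_apply (u : 𝓢(Space n, ℂ)) (k : Fin n) (η : Space n) :
    𝓕 (∂_{(EuclideanSpace.single k 1 : Space n)} u) η =
      2 * Real.pi * Complex.I * ((η k : ℂ) * 𝓕 u η) := by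
  have h : (inner ℝ · (EuclideanSpace.single k 1 : Space n)).HasTemperateGrowth :=
    ((innerSL ℝ).flip _).hasTemperateGrowth
  rw [SchwartzMap.fourier_lineDerivOp_eq]
  rw [smul_apply, SchwartzMap.smulLeftCLM_apply_apply h,
    EuclideanSpace.inner_single_right]
  simp

theorem saintVenant_eq_zero_of_elasticRayTransform {f : SchwartzTensor n}
    (hf : elasticRayTransform f = 0) : saintVenant f = 0 := by
  funext i j k x
  set e : Fin n → Space n := fun k => EuclideanSpace.single k 1 with he
  have hF : 𝓕 (∂_{e k} (complexify (f.comp i j))) = 𝓕 (∂_{e j} (complexify (f.comp i k))) := by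
    ext η
    simp only [he]
    rw [fourier_lineDerivOp_apply, fourier_lineDerivOp_apply]
    have h := sum_fourier_row_eq_zero hf i (ξ := η k • e j - η j • e k) (η := η) (by
      simp [he, inner_sub_left, inner_smul_left, EuclideanSpace.inner_single_left]; ring)
    simp [he, sub_mul, Finset.sum_sub_distrib, apply_ite Complex.ofReal] at h
    rw [sub_eq_zero.1 h]
  have hE : ∂_{e k} (complexify (f.comp i j)) = ∂_{e j} (complexify (f.comp i k)) := by
    have := congrArg 𝓕⁻ hF
    simpa using this
  have hx := congrArg (fun u : 𝓢(Space n, ℂ) => u x) hE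
  simp only [he, lineDerivOp_complexify_apply, Complex.ofReal_inj] at hx
  simp [saintVenant, hx]

end ElasticRay

theorem mainTheorem6 (n : ℕ) (hn : 2 ≤ n) (f : ElasticRay.SchwartzTensor n) :
    List.TFAE [
      ElasticRay.elasticRayTransform f = 0,
      ∃ φ : ElasticRay.Space n → ℝ, ContDiff ℝ ∞ φ ∧
        (∀ i j x, f.comp i j x =
          ElasticRay.innerDiffVector (ElasticRay.innerDiffScalar φ) i j x) ∧
        Tendsto φ (cocompact (ElasticRay.Space n)) (𝓝 0) ∧
        ∀ i, Tendsto (ElasticRay.partialDeriv i φ) (cocompact (ElasticRay.Space n)) (𝓝 0),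
      ElasticRay.saintVenant f = 0] := by
  tfae_have 1 → 3 := ElasticRay.saintVenant_eq_zero_of_elasticRayTransform
  tfae_have 3 → 1 := ElasticRay.elasticRayTransform_eq_zero_of_saintVenant hn
  tfae_have 2 → 3 := fun ⟨_, hφ, hf, _⟩ => ElasticRay.saintVenant_eq_zero_of_potential f hφ hf
  tfae_have 3 → 2 := fun h => by
    obtain ⟨φ, u, hu, hf⟩ := ElasticRay.exists_schwartz_potential_of_saintVenant hn h
    exact ⟨φ, φ.smooth ⊤, hf, zero_at_infty φ, fun i => hu i ▸ zero_at_infty (u i)⟩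
  tfae_finish
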